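/- **Theorem (Torsional rigidity).** Let $n\ge 2$ and let $\omega\subset\mathbb R^{n-1}$ be a bounded domain with $C^1$ boundary. Let $h_\pm\in C(\overline\omega)\cap C^1(\omega)$ be such that $H:=h_-+h_+>0$ in $\omega$ and $H=0$ on $\partial\omega$, and put $d:=h_+-h_-$, $p:=h_+h_-$. Define functions on $\omega$ by $$\alpha_0^{(2)}:=p,\qquad \alpha_1^{(2)}:=d,\qquad \alpha_2^{(2)}:=-1,$$ and, for $j\ge 2$, by $$\alpha_i^{(2j)}:=-\frac{1}{i(i-1)}\,\Delta\alpha_{i-2}^{(2j-2)}\quad(2\le i\le 2j-1),$$ $$\alpha_1^{(2j)}:=-\sum_{i=2}^{2j-1}\alpha_i^{(2j)}\sum_{m=0}^{i-1}h_+^{m}(-h_-)^{i-m-1},\qquad \alpha_0^{(2j)}:=-\sum_{i=2}^{2j-1}\alpha_i^{(2j)}h_+^{\,i}-\alpha_1^{(2j)}h_+ .$$ Assume that $h_\pm$ are such that all the functions $\alpha_i^{(2j)}$ with $1\le j\le 3$ and $0\le i\le 2j-1$ belong to $C^2(\overline\omega)$, that is, they are $C^2$ in $\omega$ and their derivatives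 of order at most $2$ extend continuously to $\overline\omega$. For $\varepsilon>0$ let $$\Omega_\varepsilon:=\{(x',x_n)\in\mathbb R^{n}: x'\in\omega,\ -\varepsilon h_-(x')<x_n<\varepsilon h_+(x')\},$$ and, for all sufficiently small $\varepsilon>0$, let $u_\varepsilon\in C^2(\Omega_\varepsilon)\cap C(\overline{\Omega_\varepsilon})$ be the solution of $$-\Delta u_\varepsilon=2\ \text{ in }\Omega_\varepsilon,\qquad u_\varepsilon=0\ \text{ on }\partial\Omega_\varepsilon .$$ Put $A:=(d^2+p)\Delta d+3d\,\Delta p$ and $B:=dp\,\Delta d+3p\,\Delta p$. Then, in $\omega$, $$\alpha_1^{(6)}=\tfrac1{12}d\,\Delta B+\tfrac1{36}(d^2+p)\Delta A-\tfrac1{24}d(d^2+2p)\Delta^2p-\tfrac1{120}(d^4+3d^2p+p^2)\Delta^2d,$$ $$\alpha_0^{(6)}=\tfrac1{12}p\,\Delta B+\tfrac1{36}dp\,\Delta A-\tfrac1{24}p(d^2+p)\Delta^2p-\tfrac1{120}dp(d^2+2p)\Delta^2d,$$ all integrals below converge absolutely, and, as $\varepsilon\to0^+$, $$\int_{\Omega_\varepsilon}u_\varepsilon\,dx=\frac{\varepsilon^3}{6}\int_\omega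 H^3\,dy+\frac{\varepsilon^5}{24}\int_\omega H^3\,[\,d\,\Delta d+2\Delta p\,]\,dy+\varepsilon^7\int_\omega F_7\,dy+\mathcal O(\varepsilon^8),$$ where $$\begin{aligned}F_7={}&\tfrac1{720}\,[H^3d^3+3dp^2H]\,\Delta^2d+\tfrac1{120}\,\{H^3d^2+pH(p-d^2)\}\,\Delta^2p\\&-\tfrac1{144}\,[H^3d-2dpH]\,\Delta A-\tfrac1{36}\,[H^3-3pH]\,\Delta B+\tfrac12\,dH\alpha_1^{(6)}+H\alpha_0^{(6)}.\end{aligned}$$ -/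

import Mathlib

open Set Filter Topology MeasureTheory Asymptotics
open scoped Laplacian

namespace ThinDomain

/-- `ℝᵐ` with its Euclidean norm. -/
abbrev Space (m : ℕ) := EuclideanSpace ℝ (Fin m)

/-- The boundary of `ω` is of class `C¹`: near each boundary point, `ω` is the sublevel set
`{ρ < 0}` of a `C¹` function with nonvanishing differential. -/
def HasC1Boundary {m : ℕ} (ω : Set (Space m)) : Prop :=
  ∀ x₀ ∈ frontier ω, ∃ U : Set (Space m), IsOpen U ∧ x₀ ∈ U ∧
    ∃ ρ : Space m → ℝ, ContDiffOn ℝ 1 ρ U ∧ (∀ x ∈ U, fderiv ℝ ρ x ≠ 0) ∧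
      ω ∩ U = {x ∈ U | ρ x < 0}

/-- `f ∈ C²(closure ω)` for an open set `ω`: `f` is `C²` in `ω`, and `f` and all its derivatives
of order at most two have continuous extensions from `ω` to the closure of `ω`. -/
def C2UpToBoundary {m : ℕ} (ω : Set (Space m)) (f : Space m → ℝ) : Prop :=
  ContDiffOn ℝ 2 f ω ∧
    ∀ k : ℕ, k ≤ 2 → ∃ g : Space m → ContinuousMultilinearMap ℝ (fun _ : Fin k => Space m) ℝ,
      ContinuousOn g (closure ω) ∧ EqOn (iteratedFDeriv ℝ k f) g ω

/-- The first `m` coordinates `x'` of `x = (x', xₙ) ∈ ℝᵐ⁺¹`. -/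
def horizontal {m : ℕ} (x : Space (m + 1)) : Space m :=
  WithLp.toLp 2 fun i : Fin m => x i.castSucc

/-- The last coordinate `xₙ` of `x = (x', xₙ) ∈ ℝᵐ⁺¹`. -/
def vertical {m : ℕ} (x : Space (m + 1)) : ℝ := x (Fin.last m)

/-- The thin domain `{x : x' ∈ ω, -ε h₋(x') < xₙ < ε h₊(x')}`. -/
def thinDomain {m : ℕ} (ω : Set (Space m)) (hminus hplus : Space m → ℝ) (ε : ℝ) :
    Set (Space (m + 1)) :=
  {x | horizontal x ∈ ω ∧ -(ε * hminus (horizontal x)) < vertical x ∧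
    vertical x < ε * hplus (horizontal x)}

/-- `u` is the classical solution, of class `C²(Ω) ∩ C(closure Ω)`, of `-Δu = 2` in `Ω`,
`u = 0` on `∂Ω`. -/
structure IsTorsionFunction {n : ℕ} (Ω : Set (Space n)) (u : Space n → ℝ) : Prop where
  contDiffOn : ContDiffOn ℝ 2 u Ω
  continuousOn : ContinuousOn u (closure Ω)
  equation : ∀ x ∈ Ω, -(Δ u) x = 2
  boundary : ∀ x ∈ frontier Ω, u x = 0

section Coefficients

variable {m : ℕ} (hminus hplus : Space m → ℝ)

/-- `H = h₋ + h₊`. -/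
def thickness : Space m → ℝ := fun y => hminus y + hplus y

/-- `d = h₊ - h₋`. -/
def heightDiff : Space m → ℝ := fun y => hplus y - hminus y

/-- `p = h₊ h₋`. -/
def heightProd : Space m → ℝ := fun y => hplus y * hminus y

/-- `α_i^{(2j)} = -Δ α_{i-2}^{(2j-2)} / (i (i-1))` for `i ≥ 2`, where `prev k` stands for
`α_k^{(2j-2)}`. -/
noncomputable def alphaHigh (prev : ℕ → Space m → ℝ) (i : ℕ) : Space m → ℝ :=
  fun y => -(1 / ((i : ℝ) * ((i : ℝ) - 1))) * (Δ (prev (i - 2))) y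

/-- `α_1^{(2j)}` in terms of the functions `prev k = α_k^{(2j-2)}`. -/
noncomputable def alphaOne (j : ℕ) (prev : ℕ → Space m → ℝ) : Space m → ℝ :=
  fun y => -∑ i ∈ Finset.Icc 2 (2 * j - 1), alphaHigh prev i y *
    ∑ k ∈ Finset.range i, hplus y ^ k * (-hminus y) ^ (i - k - 1)

/-- `α_0^{(2j)} = -U_{2j}(·, h₊) - α_1^{(2j)} h₊` in terms of the functions
`prev k = α_k^{(2j-2)}`. -/
noncomputable def alphaZero (j : ℕ) (prev : ℕ → Space m → ℝ) : Space m → ℝ :=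
  fun y => -(∑ i ∈ Finset.Icc 2 (2 * j - 1), alphaHigh prev i y * hplus y ^ i) -
    alphaOne hminus hplus j prev y * hplus y

/-- `alpha hminus hplus j i` is the coefficient function `α_i^{(2j)}`, for `j ≥ 1`; the value at
`j = 0` is not used. -/
noncomputable def alpha : ℕ → ℕ → Space m → ℝ
  | 0, _ => fun _ => 0
  | 1, 0 => heightProd hminus hplus
  | 1, 1 => heightDiff hminus hplus
  | 1, 2 => fun _ => -1
  | 1, _ + 3 => fun _ => 0
  | j + 2, 0 => alphaZero hminus hplus (j + 2) (alpha (j + 1))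
  | j + 2, 1 => alphaOne hminus hplus (j + 2) (alpha (j + 1))
  | j + 2, i + 2 => alphaHigh (alpha (j + 1)) (i + 2)

/-- `(d² + p) Δd + 3 d Δp`. -/
noncomputable def bracketA : Space m → ℝ := fun y =>
  (heightDiff hminus hplus y ^ 2 + heightProd hminus hplus y) * (Δ (heightDiff hminus hplus)) y +
    3 * heightDiff hminus hplus y * (Δ (heightProd hminus hplus)) y

/-- `d p Δd + 3 p Δp`. -/
noncomputable def bracketB : Space m → ℝ := fun y =>
  heightDiff hminus hplus y * heightProd hminus hplus y * (Δ (heightDiff hminus hplus)) y +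
    3 * heightProd hminus hplus y * (Δ (heightProd hminus hplus)) y

end Coefficients

end ThinDomain

/-! Write `s = xₙ / ε`, so that the Laplacian becomes `Δ' + ε⁻² ∂ₛ²`, and look for `u` in the form
`∑ ε^{2j} U_j(x', s)`. The equation `-Δu = 2` forces `∂ₛ² U_1 = -2` and `∂ₛ² U_{j+1} = -Δ' U_j`. The
condition `U_j = 0` at `s = h₊` and `s = -h₋` then fixes the constant and linear coefficients of
each layer. The result is `U_1 = p + d s - s² = (h₊ - s)(s + h₋)` and, for `j ≥ 2`, a polynomial of
degree at most `2j - 1` with coefficients `α_i^{(2j)}`.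

The sum of three layers vanishes on the boundary, and its Laplacian telescopes to `-2 + O(ε⁶)`
(`laplacian_approx`). The domain lies in a slab of half-width `O(ε)`, where comparison with the
barrier `M (xₙ² - R²) / 2` bounds a function with zero boundary values by `R² / 2` times a bound for
its Laplacian (`abs_le_of_abs_laplacian_lt`). Hence `u` differs from the truncation by `O(ε⁸)`
uniformly (`exists_abs_sub_approx_le`), and integrating layer `j` along the fibres produces the term
of order `ε^{2j+1}` (`setIntegral_profile`).

The explicit formulas are algebra: `h₊` and `-h₋` are the roots of `s² = d s + p`, so symmetric
polynomials in them are polynomials in `d` and `p`, while `A = 6 α_1^{(4)}` and `B = 6 α_0^{(4)}`.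
The coefficients `α` carry information only in the open set `ω`. On its closure they are replaced by
continuous extensions `b`. -/

namespace ThinDomain

/-! ### Laplacian along coordinate lines and the weak maximum principle -/

/-- The second-order necessary condition at a local maximum. -/
lemma deriv_deriv_nonpos_of_isLocalMax {g : ℝ → ℝ} {t : ℝ} (hg : IsLocalMax g t)
    (hc : ContinuousAt g t) : deriv (deriv g) t ≤ 0 := by
  -- A positive second derivative makes `t` a local minimum as well, so `g` is locally constant and
  -- its second derivative vanishes.
  by_contra! hpos
  have hmin := isLocalMin_of_deriv_deriv_pos hpos hg.deriv_eq_zero hc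
  have hconst : g =ᶠ[𝓝 t] fun _ => g t := by
    filter_upwards [hg, hmin] with s h1 h2 using le_antisymm h1 h2
  have h0 : deriv (deriv g) t = 0 := by
    rw [hconst.deriv.deriv_eq]
    simp
  linarith

/-- The second derivative along a line in terms of the second Fréchet derivative. -/
lemma deriv_deriv_line {E : Type*} [NormedAddCommGroup E] [NormedSpace ℝ E] {f : E → ℝ} {x : E}
    (hf : ContDiffAt ℝ 2 f x) (v : E) :
    deriv (deriv fun t : ℝ => f (x + t • v)) 0 = iteratedFDeriv ℝ 2 f x ![v, v] := by
  have hline : ∀ t : ℝ, HasDerivAt (fun t : ℝ => x + t • v) v t := fun t => by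
    simpa using ((hasDerivAt_id t).smul_const v).const_add x
  have hcont : Tendsto (fun t : ℝ => x + t • v) (𝓝 0) (𝓝 x) := by
    simpa using (hline 0).continuousAt.tendsto
  have hev : ∀ᶠ y in 𝓝 x, DifferentiableAt ℝ f y := by
    filter_upwards [hf.eventually (by simp)] with y hy using hy.differentiableAt (by simp)
  have hfirst : (deriv fun t : ℝ => f (x + t • v)) =ᶠ[𝓝 0]
      fun t : ℝ => fderiv ℝ f (x + t • v) v := by
    filter_upwards [hcont.eventually hev] with t ht
    exact (ht.hasFDerivAt.comp_hasDerivAt t (hline t)).deriv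
  have hd : DifferentiableAt ℝ (fderiv ℝ f) x :=
    (hf.fderiv_right (m := 1) (by norm_num)).differentiableAt (by simp)
  have hd' : HasFDerivAt (fun y => fderiv ℝ f y v)
      ((ContinuousLinearMap.apply ℝ ℝ v).comp (fderiv ℝ (fderiv ℝ f) x)) x :=
    (ContinuousLinearMap.apply ℝ ℝ v).hasFDerivAt.comp x hd.hasFDerivAt
  rw [hfirst.deriv_eq, iteratedFDeriv_two_apply]
  have h : HasDerivAt ((fun y => fderiv ℝ f y v) ∘ fun t : ℝ => x + t • v)
      (((ContinuousLinearMap.apply ℝ ℝ v).comp (fderiv ℝ (fderiv ℝ f) x)) v) 0 :=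
    hd'.comp_hasDerivAt_of_eq 0 (hline 0) (by simp)
  exact h.deriv

lemma laplacian_eq_sum_deriv_deriv {n : ℕ} {f : Space n → ℝ} {x : Space n}
    (hf : ContDiffAt ℝ 2 f x) :
    (Δ f) x = ∑ i, deriv (deriv fun t : ℝ => f (x + t • EuclideanSpace.single i 1)) 0 := by
  rw [InnerProductSpace.laplacian_eq_iteratedFDeriv_orthonormalBasis f
    (EuclideanSpace.basisFun (Fin n) ℝ)]
  exact Finset.sum_congr rfl fun i _ => by rw [deriv_deriv_line hf]; simp

lemma laplacian_nonpos_of_isLocalMax {n : ℕ} {f : Space n → ℝ} {x : Space n}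
    (hf : ContDiffAt ℝ 2 f x) (hmax : IsLocalMax f x) : (Δ f) x ≤ 0 := by
  rw [laplacian_eq_sum_deriv_deriv hf]
  refine Finset.sum_nonpos fun i _ => deriv_deriv_nonpos_of_isLocalMax ?_ ?_
  · have hc : ContinuousAt (fun t : ℝ => x + t • EuclideanSpace.single i (1 : ℝ)) 0 := by fun_prop
    have hmax' : IsLocalMax f (x + (0 : ℝ) • EuclideanSpace.single i (1 : ℝ)) := by simpa using hmax
    exact IsLocalMax.comp_continuous (g := fun t : ℝ => x + t • EuclideanSpace.single i (1 : ℝ))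
      (b := (0 : ℝ)) hmax' hc
  · have h1 : ContinuousAt f (x + (0 : ℝ) • EuclideanSpace.single i (1 : ℝ)) := by
      simpa using hf.continuousAt
    exact ContinuousAt.comp (f := fun t : ℝ => x + t • EuclideanSpace.single i (1 : ℝ)) h1
      (by fun_prop)

/-- The weak maximum principle for strictly subharmonic functions. -/
lemma le_zero_of_laplacian_pos {n : ℕ} {Ω : Set (Space n)} (hΩ : IsOpen Ω)
    (hb : Bornology.IsBounded Ω) {w : Space n → ℝ} (hw : ContDiffOn ℝ 2 w Ω)
    (hc : ContinuousOn w (closure Ω)) (hΔ : ∀ x ∈ Ω, 0 < (Δ w) x)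
    (hbd : ∀ x ∈ frontier Ω, w x ≤ 0) {x : Space n} (hx : x ∈ closure Ω) : w x ≤ 0 := by
  obtain ⟨z, hz, hmax⟩ := hb.isCompact_closure.exists_isMaxOn ⟨x, hx⟩ hc
  refine (hmax hx).trans ?_
  by_cases hzΩ : z ∈ Ω
  · have hloc : IsLocalMax w z := by
      filter_upwards [hΩ.mem_nhds hzΩ] with y hy using hmax (subset_closure hy)
    exact absurd (laplacian_nonpos_of_isLocalMax (hw.contDiffAt (hΩ.mem_nhds hzΩ)) hloc)
      (not_le.mpr (hΔ z hzΩ))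
  · exact hbd z (by rw [frontier, hΩ.interior_eq]; exact ⟨hz, hzΩ⟩)

/-! ### Polynomials in the scaled vertical variable and their Laplacian -/

/-- The coordinate projection `x ↦ x'` as a continuous linear map. -/
noncomputable def horizontalCLM (m : ℕ) : Space (m + 1) →L[ℝ] Space m :=
  LinearMap.toContinuousLinearMap
    { toFun := horizontal
      map_add' := fun x y => by ext i; simp [horizontal]
      map_smul' := fun c x => by ext i; simp [horizontal] }

lemma contDiff_horizontal {m : ℕ} {k : WithTop ℕ∞} : ContDiff ℝ k (horizontal (m := m)) :=
  (horizontalCLM m).contDiff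

lemma continuous_horizontal {m : ℕ} : Continuous (horizontal (m := m)) :=
  (horizontalCLM m).continuous

lemma contDiff_vertical {m : ℕ} {k : WithTop ℕ∞} : ContDiff ℝ k (vertical (m := m)) :=
  (EuclideanSpace.proj (𝕜 := ℝ) (Fin.last m)).contDiff

lemma continuous_vertical {m : ℕ} : Continuous (vertical (m := m)) :=
  (EuclideanSpace.proj (𝕜 := ℝ) (Fin.last m)).continuous

lemma horizontal_add_single_castSucc {m : ℕ} (x : Space (m + 1)) (t : ℝ) (i : Fin m) :
    horizontal (x + t • EuclideanSpace.single i.castSucc 1) =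
      horizontal x + t • EuclideanSpace.single i 1 := by
  ext k
  simp [horizontal, Fin.castSucc_inj]

lemma vertical_add_single_castSucc {m : ℕ} (x : Space (m + 1)) (t : ℝ) (i : Fin m) :
    vertical (x + t • EuclideanSpace.single i.castSucc 1) = vertical x := by
  simp [vertical, (Fin.castSucc_lt_last i).ne']

lemma horizontal_add_single_last {m : ℕ} (x : Space (m + 1)) (t : ℝ) :
    horizontal (x + t • EuclideanSpace.single (Fin.last m) 1) = horizontal x := by
  ext k
  simp [horizontal]

lemma vertical_add_single_last {m : ℕ} (x : Space (m + 1)) (t : ℝ) :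
    vertical (x + t • EuclideanSpace.single (Fin.last m) 1) = vertical x + t := by
  simp [vertical]

lemma contDiffAt_monomial {m : ℕ} {a : Space m → ℝ} {x : Space (m + 1)}
    (ha : ContDiffAt ℝ 2 a (horizontal x)) (ε : ℝ) (i : ℕ) :
    ContDiffAt ℝ 2 (fun x => a (horizontal x) * (vertical x / ε) ^ i) x :=
  (ha.comp x contDiff_horizontal.contDiffAt).mul
    ((contDiff_vertical.contDiffAt.div_const ε).pow i)

lemma deriv_deriv_shifted_pow (c s ε : ℝ) (i : ℕ) :
    deriv (deriv fun t : ℝ => c * ((s + t) / ε) ^ i) 0 =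
      c * ((i : ℝ) * ((i : ℝ) - 1) * (s / ε) ^ (i - 2) / ε ^ 2) := by
  have hlin : ∀ t : ℝ, HasDerivAt (fun t : ℝ => (s + t) / ε) (1 / ε) t := fun t =>
    ((hasDerivAt_id t).const_add s).div_const ε
  have h1 : (deriv fun t : ℝ => c * ((s + t) / ε) ^ i) =
      fun t => c * ((i : ℝ) * ((s + t) / ε) ^ (i - 1) * (1 / ε)) :=
    funext fun t => (((hlin t).pow i).const_mul c).deriv
  have h2 : HasDerivAt (fun t : ℝ => c * ((i : ℝ) * ((s + t) / ε) ^ (i - 1) * (1 / ε))) _ 0 :=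
    ((((hlin 0).pow (i - 1)).const_mul (i : ℝ)).mul_const (1 / ε)).const_mul c
  rw [h1, h2.deriv]
  -- The truncated exponent `i - 2` is harmless: the factor `i (i - 1)` vanishes for `i = 0` and `i
  -- = 1`.
  rcases i with _ | _ | i
  · simp
  · simp
  · simp only [Nat.add_sub_cancel, add_zero]
    push_cast
    ring

/-- The Laplacian of `a(x') (xₙ / ε) ^ i`. -/
lemma laplacian_monomial {m : ℕ} {a : Space m → ℝ} {x : Space (m + 1)}
    (ha : ContDiffAt ℝ 2 a (horizontal x)) (ε : ℝ) (i : ℕ) :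
    (Δ fun x => a (horizontal x) * (vertical x / ε) ^ i) x =
      (Δ a) (horizontal x) * (vertical x / ε) ^ i +
        a (horizontal x) * ((i : ℝ) * ((i : ℝ) - 1) * (vertical x / ε) ^ (i - 2) / ε ^ 2) := by
  rw [laplacian_eq_sum_deriv_deriv (contDiffAt_monomial ha ε i), Fin.sum_univ_castSucc,
    laplacian_eq_sum_deriv_deriv ha, Finset.sum_mul]
  simp only [horizontal_add_single_castSucc, vertical_add_single_castSucc,
    horizontal_add_single_last, vertical_add_single_last, deriv_deriv_shifted_pow]
  congr 1
  refine Finset.sum_congr rfl fun k _ => ?_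
  have : (deriv fun t : ℝ => a (horizontal x + t • EuclideanSpace.single k 1) *
      (vertical x / ε) ^ i) = fun t =>
        deriv (fun t : ℝ => a (horizontal x + t • EuclideanSpace.single k 1)) t *
          (vertical x / ε) ^ i := funext fun t => deriv_mul_const_field _
  rw [this, deriv_mul_const_field]

/-- The function `∑ i < n, a i (x') (xₙ / ε) ^ i`. -/
noncomputable def profile {m : ℕ} (n : ℕ) (a : ℕ → Space m → ℝ) (ε : ℝ) (x : Space (m + 1)) : ℝ :=
  ∑ i ∈ Finset.range n, a i (horizontal x) * (vertical x / ε) ^ i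

lemma contDiffAt_profile {m n : ℕ} {a : ℕ → Space m → ℝ} {x : Space (m + 1)}
    (ha : ∀ i < n, ContDiffAt ℝ 2 (a i) (horizontal x)) (ε : ℝ) :
    ContDiffAt ℝ 2 (profile n a ε) x :=
  ContDiffAt.sum fun i hi => contDiffAt_monomial (ha i (Finset.mem_range.mp hi)) ε i

lemma laplacian_profile {m n : ℕ} {a : ℕ → Space m → ℝ} {x : Space (m + 1)}
    (ha : ∀ i < n, ContDiffAt ℝ 2 (a i) (horizontal x)) (ε : ℝ) :
    (Δ (profile n a ε)) x = ∑ i ∈ Finset.range n,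
      ((Δ (a i)) (horizontal x) * (vertical x / ε) ^ i + a i (horizontal x) *
        ((i : ℝ) * ((i : ℝ) - 1) * (vertical x / ε) ^ (i - 2) / ε ^ 2)) := by
  induction n with
  | zero =>
    have : profile 0 a ε = fun _ => 0 := by ext; simp [profile]
    simp [this]
  | succ n ih =>
    have hsplit : profile (n + 1) a ε =
        profile n a ε + fun x => a n (horizontal x) * (vertical x / ε) ^ n := by
      ext z
      simp [profile, Finset.sum_range_succ]
    rw [hsplit, (contDiffAt_profile (fun i hi => ha i (by omega)) ε).laplacian_add
      (contDiffAt_monomial (ha n (by omega)) ε n), ih fun i hi => ha i (by omega),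
      laplacian_monomial (ha n (by omega)), Finset.sum_range_succ]

/-! ### A priori bound in a slab -/

/-- One half of the a priori bound in a slab. -/
lemma le_of_abs_laplacian_lt {m : ℕ} {Ω : Set (Space (m + 1))} (hΩ : IsOpen Ω)
    (hb : Bornology.IsBounded Ω) {R M : ℝ} (hR : ∀ x ∈ closure Ω, |vertical x| ≤ R) (hM : 0 ≤ M)
    {w : Space (m + 1) → ℝ} (hw : ContDiffOn ℝ 2 w Ω) (hc : ContinuousOn w (closure Ω))
    (hΔ : ∀ x ∈ Ω, |(Δ w) x| < M) (hbd : ∀ x ∈ frontier Ω, w x = 0)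
    {x : Space (m + 1)} (hx : x ∈ closure Ω) : w x ≤ M * R ^ 2 / 2 := by
  -- Coefficients of the barrier `M (xₙ² - R²) / 2`, a profile with `ε = 1`. Its Laplacian is `M`
  -- and it is nonpositive in the slab, so `w` plus the barrier is strictly subharmonic and at most
  -- zero on the boundary.
  set a : ℕ → Space m → ℝ := fun i _ => if i = 0 then -(M * R ^ 2 / 2) else
    if i = 2 then M / 2 else 0
  have hq : ∀ z, profile 3 a 1 z = M / 2 * (vertical z ^ 2 - R ^ 2) := fun z => by
    simp [profile, Finset.sum_range_succ, a]; ring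
  have hq2 : ∀ z, ContDiffAt ℝ 2 (profile 3 a 1) z := fun z =>
    contDiffAt_profile (fun i _ => contDiffAt_const) 1
  have hqΔ : ∀ z, (Δ (profile 3 a 1)) z = M := fun z => by
    rw [laplacian_profile (fun i _ => contDiffAt_const) 1]
    simp [Finset.sum_range_succ]; ring
  have hsq : ∀ z ∈ closure Ω, vertical z ^ 2 ≤ R ^ 2 := fun z hz => by
    have := abs_le.mp (hR z hz)
    nlinarith [this.1, this.2]
  have key := le_zero_of_laplacian_pos hΩ hb (w := w + profile 3 a 1)
    (fun z hz => ((hw z hz).add (hq2 z).contDiffWithinAt))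
    (hc.add fun z _ => (hq2 z).continuousAt.continuousWithinAt)
    (fun z hz => by
      rw [(hw.contDiffAt (hΩ.mem_nhds hz)).laplacian_add (hq2 z), hqΔ]
      linarith [(abs_lt.mp (hΔ z hz)).1])
    (fun z hz => by
      have h1 := hsq z (frontier_subset_closure hz)
      rw [Pi.add_apply, hbd z hz, hq]
      nlinarith) hx
  rw [Pi.add_apply, hq] at key
  nlinarith [sq_nonneg (vertical x)]

/-- An a priori bound for the Dirichlet problem in a domain contained in a slab of
half-width `R`. -/
lemma abs_le_of_abs_laplacian_lt {m : ℕ} {Ω : Set (Space (m + 1))} (hΩ : IsOpen Ω)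
    (hb : Bornology.IsBounded Ω) {R M : ℝ} (hR : ∀ x ∈ closure Ω, |vertical x| ≤ R) (hM : 0 ≤ M)
    {w : Space (m + 1) → ℝ} (hw : ContDiffOn ℝ 2 w Ω) (hc : ContinuousOn w (closure Ω))
    (hΔ : ∀ x ∈ Ω, |(Δ w) x| < M) (hbd : ∀ x ∈ frontier Ω, w x = 0)
    {x : Space (m + 1)} (hx : x ∈ closure Ω) : |w x| ≤ M * R ^ 2 / 2 := by
  refine abs_le.mpr ⟨?_, le_of_abs_laplacian_lt hΩ hb hR hM hw hc hΔ hbd hx⟩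
  have h := le_of_abs_laplacian_lt hΩ hb hR hM (w := -w) hw.neg hc.neg
    (fun z hz => by rw [InnerProductSpace.laplacian_neg]; simpa using hΔ z hz)
    (fun z hz => by simp [hbd z hz]) hx
  rw [Pi.neg_apply] at h
  linarith

lemma continuousOn_comp_horizontal {m : ℕ} {s : Set (Space m)} {f : Space m → ℝ}
    (hf : ContinuousOn f s) : ContinuousOn (fun x => f (horizontal x)) (horizontal ⁻¹' s) :=
  hf.comp continuous_horizontal.continuousOn fun _ hx => hx

lemma continuousOn_profile {m n : ℕ} {a : ℕ → Space m → ℝ} {s : Set (Space m)}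
    (ha : ∀ i < n, ContinuousOn (a i) s) (ε : ℝ) :
    ContinuousOn (profile n a ε) (horizontal ⁻¹' s) :=
  continuousOn_finsetSum _ fun i hi =>
    (continuousOn_comp_horizontal (ha i (Finset.mem_range.mp hi))).mul
      ((continuous_vertical.div_const ε).pow i).continuousOn

lemma integrableOn_of_continuousOn_closure {n : ℕ} {s : Set (Space n)} {f : Space n → ℝ}
    (hs : Bornology.IsBounded s) (hf : ContinuousOn f (closure s)) : IntegrableOn f s :=
  (hf.integrableOn_compact hs.isCompact_closure).mono_set subset_closure

/-! ### Topology and size of the thin domain -/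

section Geometry

variable {m : ℕ} {ω : Set (Space m)} {hminus hplus : Space m → ℝ} {ε : ℝ}

lemma isOpen_thinDomain (hω : IsOpen ω) (h₁ : ContinuousOn hminus ω) (h₂ : ContinuousOn hplus ω) :
    IsOpen (thinDomain ω hminus hplus ε) := by
  have h1 := continuousOn_comp_horizontal h₁
  have h2 := continuousOn_comp_horizontal h₂
  have hc : ContinuousOn (fun x : Space (m + 1) =>
      (vertical x + ε * hminus (horizontal x), ε * hplus (horizontal x) - vertical x))
      (horizontal ⁻¹' ω) :=
    (continuous_vertical.continuousOn.add (continuousOn_const.mul h1)).prodMk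
      ((continuousOn_const.mul h2).sub continuous_vertical.continuousOn)
  convert hc.isOpen_inter_preimage (hω.preimage continuous_horizontal)
    (isOpen_Ioi.prod isOpen_Ioi : IsOpen (Ioi (0 : ℝ) ×ˢ Ioi (0 : ℝ))) using 1
  ext x
  simp only [thinDomain, mem_ofPred_eq, mem_inter_iff, mem_preimage, mem_prod, mem_Ioi]
  refine and_congr_right fun _ => and_congr ?_ ?_ <;> constructor <;> intro h <;> linarith

lemma closure_thinDomain_subset (h₁ : ContinuousOn hminus (closure ω))
    (h₂ : ContinuousOn hplus (closure ω)) : closure (thinDomain ω hminus hplus ε) ⊆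
      {x | horizontal x ∈ closure ω ∧ -(ε * hminus (horizontal x)) ≤ vertical x ∧
        vertical x ≤ ε * hplus (horizontal x)} := by
  have h1 := continuousOn_comp_horizontal h₁
  have h2 := continuousOn_comp_horizontal h₂
  have hc : ContinuousOn (fun x : Space (m + 1) =>
      (vertical x + ε * hminus (horizontal x), ε * hplus (horizontal x) - vertical x))
      (horizontal ⁻¹' closure ω) :=
    (continuous_vertical.continuousOn.add (continuousOn_const.mul h1)).prodMk
      ((continuousOn_const.mul h2).sub continuous_vertical.continuousOn)
  have hcl := hc.preimage_isClosed_of_isClosed (isClosed_closure.preimage continuous_horizontal)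
    (isClosed_Ici.prod isClosed_Ici : IsClosed (Ici (0 : ℝ) ×ˢ Ici (0 : ℝ)))
  refine (closure_minimal (fun x hx => ?_) hcl).trans fun x hx => ?_
  · refine ⟨subset_closure hx.1, ?_, ?_⟩
    · simp only [mem_Ici]; linarith [hx.2.1]
    · simp only [mem_Ici]; linarith [hx.2.2]
  · obtain ⟨h, h', h''⟩ := hx
    simp only [mem_Ici] at h' h''
    exact ⟨h, by linarith, by linarith⟩

/-- The lateral boundary needs no separate treatment: over `∂ω` the thickness is zero, so the closed
fibre collapses to a point where both alternatives hold. Over `ω`, a point strictly between the two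
graphs is interior. -/
lemma frontier_thinDomain_subset (hω : IsOpen ω) (h₁ : ContinuousOn hminus (closure ω))
    (h₂ : ContinuousOn hplus (closure ω)) (hH : ∀ y ∈ frontier ω, hminus y + hplus y = 0) :
    frontier (thinDomain ω hminus hplus ε) ⊆ {x | horizontal x ∈ closure ω ∧
      (vertical x = ε * hplus (horizontal x) ∨ vertical x = ε * -hminus (horizontal x))} := by
  intro x hx
  rw [frontier, (isOpen_thinDomain hω (h₁.mono subset_closure)
    (h₂.mono subset_closure)).interior_eq] at hx
  obtain ⟨hy, hlo, hhi⟩ := closure_thinDomain_subset h₁ h₂ hx.1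
  refine ⟨hy, ?_⟩
  by_contra! hne
  have hlo' : -(ε * hminus (horizontal x)) < vertical x :=
    lt_of_le_of_ne hlo fun h => hne.2 (by linarith)
  by_cases hyω : horizontal x ∈ ω
  · exact hx.2 ⟨hyω, hlo', lt_of_le_of_ne hhi hne.1⟩
  · have h0 := hH (horizontal x) (by rw [frontier, hω.interior_eq]; exact ⟨hy, hyω⟩)
    have : ε * hplus (horizontal x) = -(ε * hminus (horizontal x)) := by
      linear_combination ε * h0
    linarith

lemma abs_vertical_le {K : ℝ} (hε : 0 < ε) (h₁ : ContinuousOn hminus (closure ω))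
    (h₂ : ContinuousOn hplus (closure ω)) (hK : ∀ y ∈ closure ω, |hminus y| ≤ K ∧ |hplus y| ≤ K)
    {x : Space (m + 1)} (hx : x ∈ closure (thinDomain ω hminus hplus ε)) :
    |vertical x| ≤ ε * K := by
  obtain ⟨hy, hlo, hhi⟩ := closure_thinDomain_subset h₁ h₂ hx
  obtain ⟨k1, k2⟩ := hK _ hy
  have e1 := mul_le_mul_of_nonneg_left (le_of_abs_le k1) hε.le
  have e2 := mul_le_mul_of_nonneg_left (le_of_abs_le k2) hε.le
  exact abs_le.mpr ⟨by linarith, by linarith⟩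

lemma norm_sq_eq_horizontal_vertical (x : Space (m + 1)) :
    ‖x‖ ^ 2 = ‖horizontal x‖ ^ 2 + vertical x ^ 2 := by
  simp [EuclideanSpace.norm_sq_eq, Fin.sum_univ_castSucc, horizontal, vertical]

/-- For `ε ≤ 1` the thin domains lie in a common ball. -/
lemma thinDomain_subset_closedBall {K R : ℝ} (hε : 0 < ε) (hε1 : ε ≤ 1) (hK0 : 0 ≤ K)
    (hR0 : 0 ≤ R) (hR : ω ⊆ Metric.closedBall 0 R) (h₁ : ContinuousOn hminus (closure ω))
    (h₂ : ContinuousOn hplus (closure ω)) (hK : ∀ y ∈ closure ω, |hminus y| ≤ K ∧ |hplus y| ≤ K) :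
    thinDomain ω hminus hplus ε ⊆ Metric.closedBall 0 (R + K) := by
  intro x hx
  have hv := abs_vertical_le hε h₁ h₂ hK (subset_closure hx)
  have hv' : |vertical x| ≤ K := hv.trans (mul_le_of_le_one_left hK0 hε1)
  have hh : ‖horizontal x‖ ≤ R := by simpa using hR hx.1
  rw [mem_closedBall_zero_iff]
  refine le_of_sq_le_sq ?_ (by positivity)
  rw [norm_sq_eq_horizontal_vertical, ← sq_abs (vertical x)]
  nlinarith [norm_nonneg (horizontal x), abs_nonneg (vertical x), mul_nonneg hR0 hK0]

end Geometry

/-! ### Integration along vertical fibres -/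

section Fubini

/-- The splitting `x ↦ (x', xₙ)` as a measurable equivalence. -/
noncomputable def splitEquiv (m : ℕ) : Space (m + 1) ≃ᵐ Space m × ℝ :=
  (MeasurableEquiv.toLp 2 (Fin (m + 1) → ℝ)).symm.trans
    ((MeasurableEquiv.piFinSuccAbove (fun _ => ℝ) (Fin.last m)).trans
      (MeasurableEquiv.prodComm.trans
        ((MeasurableEquiv.toLp 2 (Fin m → ℝ)).prodCongr (MeasurableEquiv.refl ℝ))))

lemma splitEquiv_apply {m : ℕ} (x : Space (m + 1)) :
    splitEquiv m x = (horizontal x, vertical x) := by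
  refine Prod.ext ?_ rfl
  ext i
  change x ((Fin.last m).succAbove i) = x i.castSucc
  rw [Fin.succAbove_last]

lemma measurePreserving_splitEquiv (m : ℕ) : MeasurePreserving (splitEquiv m) := by
  have h1 := EuclideanSpace.volume_preserving_symm_measurableEquiv_toLp (Fin (m + 1))
  have h2 := volume_preserving_piFinSuccAbove (fun _ : Fin (m + 1) => ℝ) (Fin.last m)
  have h3 : MeasurePreserving (Prod.swap : ℝ × (Fin m → ℝ) → (Fin m → ℝ) × ℝ) :=
    Measure.measurePreserving_swap
  have h4 : MeasurePreserving (Prod.map (WithLp.toLp 2 : (Fin m → ℝ) → Space m) (id : ℝ → ℝ)) :=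
    (PiLp.volume_preserving_toLp (Fin m)).prod (MeasurePreserving.id _)
  exact h4.comp (h3.comp (h2.comp h1))

variable {m : ℕ} {ω : Set (Space m)} {hminus hplus : Space m → ℝ} {ε : ℝ}

/-- Fubini's theorem in a thin domain. -/
lemma setIntegral_thinDomain (hω : IsOpen ω) (h₁ : ContinuousOn hminus ω)
    (h₂ : ContinuousOn hplus ω) (hle : ∀ y ∈ ω, -(ε * hminus y) ≤ ε * hplus y)
    (F : Space m × ℝ → ℝ) (hF : IntegrableOn (fun x => F (horizontal x, vertical x))
      (thinDomain ω hminus hplus ε)) :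
    ∫ x in thinDomain ω hminus hplus ε, F (horizontal x, vertical x) =
      ∫ y in ω, ∫ t in (-(ε * hminus y))..(ε * hplus y), F (y, t) := by
  set T : Set (Space m × ℝ) :=
    {z | z.1 ∈ ω ∧ -(ε * hminus z.1) < z.2 ∧ z.2 < ε * hplus z.1} with hT
  have hpre : thinDomain ω hminus hplus ε = splitEquiv m ⁻¹' T := by
    ext x
    simp only [mem_preimage, splitEquiv_apply, hT]
    rfl
  have hTm : MeasurableSet T := by
    rw [← (splitEquiv m).measurableSet_preimage, ← hpre]
    exact (isOpen_thinDomain hω h₁ h₂).measurableSet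
  have hmp := measurePreserving_splitEquiv m
  have hcomp : (fun x => F (horizontal x, vertical x)) = F ∘ splitEquiv m :=
    funext fun x => by simp [splitEquiv_apply]
  have hFT : IntegrableOn F T := by
    rw [hcomp, hpre] at hF
    exact (hmp.integrableOn_comp_preimage (splitEquiv m).measurableEmbedding).mp hF
  have hind : Integrable (T.indicator F) (volume.prod volume) := by
    rw [← Measure.volume_eq_prod]
    exact (integrable_indicator_iff hTm).mpr hFT
  rw [hcomp, hpre]
  refine (hmp.setIntegral_preimage_emb (splitEquiv m).measurableEmbedding F T).trans ?_
  rw [← integral_indicator hTm,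
    Measure.volume_eq_prod, integral_prod _ hind, ← integral_indicator hω.measurableSet]
  refine integral_congr_ae (Eventually.of_forall fun y => ?_)
  by_cases hy : y ∈ ω
  · simp only [indicator_of_mem hy]
    rw [intervalIntegral.integral_of_le (hle y hy), integral_Ioc_eq_integral_Ioo,
      ← integral_indicator measurableSet_Ioo]
    refine integral_congr_ae (Eventually.of_forall fun t => ?_)
    by_cases ht : t ∈ Ioo (-(ε * hminus y)) (ε * hplus y)
    · have : (y, t) ∈ T := ⟨hy, ht.1, ht.2⟩
      simp [indicator_of_mem ht, indicator_of_mem this]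
    · have : (y, t) ∉ T := fun h => ht ⟨h.2.1, h.2.2⟩
      simp [indicator_of_notMem ht, indicator_of_notMem this]
  · simp only [indicator_of_notMem hy]
    have : ∀ t : ℝ, T.indicator F (y, t) = 0 := fun t => indicator_of_notMem (fun h => hy h.1) _
    simp [this]

/-- The integral of `∑ i < n, a i (y) s ^ i` over `-h₋(y) < s < h₊(y)`. -/
noncomputable def moment (hminus hplus : Space m → ℝ) (n : ℕ) (a : ℕ → Space m → ℝ)
    (y : Space m) : ℝ :=
  ∑ i ∈ Finset.range n, a i y * ((hplus y ^ (i + 1) - (-hminus y) ^ (i + 1)) / ((i : ℝ) + 1))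

lemma continuousOn_moment {s : Set (Space m)} {n : ℕ} {a : ℕ → Space m → ℝ}
    (h₁ : ContinuousOn hminus s) (h₂ : ContinuousOn hplus s)
    (ha : ∀ i < n, ContinuousOn (a i) s) : ContinuousOn (moment hminus hplus n a) s :=
  continuousOn_finsetSum _ fun i hi => (ha i (Finset.mem_range.mp hi)).mul
    (((h₂.pow (i + 1)).sub (h₁.neg.pow (i + 1))).div_const _)

/-- The substitution `s = xₙ / ε` maps each fibre onto `(-h₋, h₊)`, independently of `ε`, at the
cost of one factor `ε`. -/
lemma setIntegral_profile (hω : IsOpen ω) (hωb : Bornology.IsBounded ω)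
    (hb : Bornology.IsBounded (thinDomain ω hminus hplus ε)) (hε : 0 < ε)
    (h₁ : ContinuousOn hminus (closure ω)) (h₂ : ContinuousOn hplus (closure ω))
    (hH : ∀ y ∈ ω, 0 < hminus y + hplus y) {n : ℕ} {a : ℕ → Space m → ℝ}
    (ha : ∀ i < n, ContinuousOn (a i) (closure ω)) :
    IntegrableOn (profile n a ε) (thinDomain ω hminus hplus ε) ∧
    IntegrableOn (moment hminus hplus n a) ω ∧
    ∫ x in thinDomain ω hminus hplus ε, profile n a ε x =
      ε * ∫ y in ω, moment hminus hplus n a y := by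
  have hI : IntegrableOn (profile n a ε) (thinDomain ω hminus hplus ε) :=
    integrableOn_of_continuousOn_closure hb ((continuousOn_profile ha ε).mono
      fun x hx => (closure_thinDomain_subset h₁ h₂ hx).1)
  refine ⟨hI, integrableOn_of_continuousOn_closure hωb (continuousOn_moment h₁ h₂ ha), ?_⟩
  have h := setIntegral_thinDomain hω (h₁.mono subset_closure) (h₂.mono subset_closure)
    (fun y hy => by nlinarith [hH y hy])
    (fun z => ∑ i ∈ Finset.range n, a i z.1 * (z.2 / ε) ^ i) hI
  rw [← integral_const_mul]
  refine Eq.trans h (integral_congr_ae (Eventually.of_forall fun y => ?_))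
  simp only
  rw [intervalIntegral.integral_comp_div (fun s : ℝ => ∑ i ∈ Finset.range n, a i y * s ^ i) hε.ne',
    smul_eq_mul, intervalIntegral.integral_finsetSum
      fun i _ => Continuous.intervalIntegrable (by fun_prop) _ _]
  rw [show ε * hplus y / ε = hplus y by field_simp,
    show -(ε * hminus y) / ε = -hminus y by field_simp, moment]
  simp

end Fubini

/-! ### Consequences of `C²` regularity up to the boundary -/

section UpToBoundary

variable {m : ℕ} {ω : Set (Space m)} {f : Space m → ℝ}

/-- The case `k = 0` of the definition, evaluated at the empty tuple. A new function `b` is needed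
because the values of `f` itself off `ω` are unconstrained. -/
lemma C2UpToBoundary.exists_extension (hf : C2UpToBoundary ω f) :
    ∃ b : Space m → ℝ, ContinuousOn b (closure ω) ∧ EqOn b f ω := by
  obtain ⟨g, hg, hfg⟩ := hf.2 0 (by norm_num)
  refine ⟨fun y => g y 0, ?_, fun y hy => ?_⟩
  · exact (ContinuousMultilinearMap.apply ℝ (fun _ : Fin 0 => Space m) ℝ
      (0 : Fin 0 → Space m)).continuous.comp_continuousOn hg
  · simp only
    rw [← hfg hy, iteratedFDeriv_zero_apply]

lemma C2UpToBoundary.exists_bound_laplacian (hω : Bornology.IsBounded ω)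
    (hf : C2UpToBoundary ω f) : ∃ M : ℝ, ∀ y ∈ ω, |(Δ f) y| ≤ M := by
  obtain ⟨g, hg, hfg⟩ := hf.2 2 le_rfl
  have hc : ContinuousOn (fun y => ∑ i, g y ![EuclideanSpace.basisFun (Fin m) ℝ i,
      EuclideanSpace.basisFun (Fin m) ℝ i]) (closure ω) :=
    continuousOn_finsetSum _ fun i _ =>
      (ContinuousMultilinearMap.apply ℝ (fun _ : Fin 2 => Space m) ℝ _).continuous.comp_continuousOn
        hg
  obtain ⟨M, hM⟩ := hω.isCompact_closure.exists_bound_of_continuousOn hc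
  refine ⟨M, fun y hy => ?_⟩
  rw [InnerProductSpace.laplacian_eq_iteratedFDeriv_orthonormalBasis f
    (EuclideanSpace.basisFun (Fin m) ℝ)]
  simp only [hfg hy]
  exact hM y (subset_closure hy)

end UpToBoundary

/-! ### Closed forms of the coefficients, boundary values and moments of the layers -/

section Algebra

variable {m : ℕ} (hminus hplus : Space m → ℝ) (y : Space m)

lemma alpha_add_two (j i : ℕ) : alpha hminus hplus (j + 2) (i + 2) y =
    -(1 / (((i : ℝ) + 2) * ((i : ℝ) + 1))) * (Δ (alpha hminus hplus (j + 1) i)) y := by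
  simp only [alpha, alphaHigh, Nat.add_sub_cancel]
  push_cast
  ring_nf

/-- The inner sum in `alphaOne` is the complete homogeneous symmetric polynomial of degree `i - 1`
in `h₊` and `-h₋`, which have sum `d` and product `-p`. The recursion `q_k = d q_{k-1} + p q_{k-2}`
gives `1, d, d² + p, d (d² + 2p), d⁴ + 3d²p + p²`. In `alphaZero` the term of index `i` becomes
`-α_i p q_{i-2}`. The next three lemmas have the same origin. -/
lemma alpha_two_one : alpha hminus hplus 2 1 y =
    -(alpha hminus hplus 2 2 y * heightDiff hminus hplus y +
      alpha hminus hplus 2 3 y * (heightDiff hminus hplus y ^ 2 + heightProd hminus hplus y)) := by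
  have hI : Finset.Icc 2 (2 * 2 - 1) = {2, 3} := rfl
  simp only [alpha, alphaOne, hI, heightDiff, heightProd]
  simp [Finset.sum_range_succ]
  ring

lemma alpha_two_zero : alpha hminus hplus 2 0 y =
    -(alpha hminus hplus 2 2 y * heightProd hminus hplus y +
      alpha hminus hplus 2 3 y * (heightDiff hminus hplus y * heightProd hminus hplus y)) := by
  have hI : Finset.Icc 2 (2 * 2 - 1) = {2, 3} := rfl
  simp only [alpha, alphaZero, alphaOne, hI, heightDiff, heightProd]
  simp [Finset.sum_range_succ]
  ring

lemma alpha_three_one : alpha hminus hplus 3 1 y =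
    -(alpha hminus hplus 3 2 y * heightDiff hminus hplus y +
      alpha hminus hplus 3 3 y * (heightDiff hminus hplus y ^ 2 + heightProd hminus hplus y) +
      alpha hminus hplus 3 4 y * (heightDiff hminus hplus y *
        (heightDiff hminus hplus y ^ 2 + 2 * heightProd hminus hplus y)) +
      alpha hminus hplus 3 5 y * (heightDiff hminus hplus y ^ 4 +
        3 * heightDiff hminus hplus y ^ 2 * heightProd hminus hplus y +
        heightProd hminus hplus y ^ 2)) := by
  have hI : Finset.Icc 2 (2 * 3 - 1) = {2, 3, 4, 5} := rfl
  have e : ∀ i, alpha hminus hplus 3 (i + 2) = alphaHigh (alpha hminus hplus 2) (i + 2) :=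
    fun i => rfl
  rw [e 0, e 1, e 2, e 3]
  change alphaOne hminus hplus 3 (alpha hminus hplus 2) y = _
  -- With the previous layer opaque, a polynomial identity in `h₊`, `h₋` and the higher coefficients
  -- remains.
  generalize alpha hminus hplus 2 = a
  simp only [alphaOne, hI, heightDiff, heightProd]
  simp [Finset.sum_range_succ]
  ring

lemma alpha_three_zero : alpha hminus hplus 3 0 y =
    -(alpha hminus hplus 3 2 y * heightProd hminus hplus y +
      alpha hminus hplus 3 3 y * (heightDiff hminus hplus y * heightProd hminus hplus y) +
      alpha hminus hplus 3 4 y * (heightProd hminus hplus y *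
        (heightDiff hminus hplus y ^ 2 + heightProd hminus hplus y)) +
      alpha hminus hplus 3 5 y * (heightDiff hminus hplus y * heightProd hminus hplus y *
        (heightDiff hminus hplus y ^ 2 + 2 * heightProd hminus hplus y))) := by
  have hI : Finset.Icc 2 (2 * 3 - 1) = {2, 3, 4, 5} := rfl
  have e : ∀ i, alpha hminus hplus 3 (i + 2) = alphaHigh (alpha hminus hplus 2) (i + 2) :=
    fun i => rfl
  rw [e 0, e 1, e 2, e 3]
  change alphaZero hminus hplus 3 (alpha hminus hplus 2) y = _
  generalize alpha hminus hplus 2 = a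
  simp only [alphaZero, alphaOne, hI, heightDiff, heightProd]
  simp [Finset.sum_range_succ]
  ring

lemma alpha_two_two_eq : alpha hminus hplus 2 2 y = -(1 / 2) * (Δ (heightProd hminus hplus)) y := by
  rw [alpha_add_two hminus hplus y 0 0]
  norm_num [alpha]

lemma alpha_two_three_eq :
    alpha hminus hplus 2 3 y = -(1 / 6) * (Δ (heightDiff hminus hplus)) y := by
  rw [alpha_add_two hminus hplus y 0 1]
  norm_num [alpha]

/-- Equality as functions, not just at a point, so that `Δ` can be applied to both sides: this turns
`α_3^{(6)} = -Δα_1^{(4)} / 6` into `-ΔA / 36`. The next lemma does the same for `B`. -/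
lemma bracketA_eq : bracketA hminus hplus = (6 : ℝ) • alpha hminus hplus 2 1 := by
  ext y
  rw [Pi.smul_apply, smul_eq_mul, alpha_two_one, alpha_two_two_eq, alpha_two_three_eq, bracketA]
  ring

lemma bracketB_eq : bracketB hminus hplus = (6 : ℝ) • alpha hminus hplus 2 0 := by
  ext y
  rw [Pi.smul_apply, smul_eq_mul, alpha_two_zero, alpha_two_two_eq, alpha_two_three_eq, bracketB]
  ring

/-- Makes `Δ²p` a multiple of `Δα_2^{(4)}`, so that `C²` regularity of `α_2^{(4)}` suffices and no
fourth derivatives of `p` have to be discussed. Similarly for `d` below. -/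
lemma laplacian_heightProd_eq :
    Δ (heightProd hminus hplus) = (-2 : ℝ) • alpha hminus hplus 2 2 := by
  ext y
  rw [Pi.smul_apply, smul_eq_mul, alpha_two_two_eq]
  ring

lemma laplacian_heightDiff_eq :
    Δ (heightDiff hminus hplus) = (-6 : ℝ) • alpha hminus hplus 2 3 := by
  ext y
  rw [Pi.smul_apply, smul_eq_mul, alpha_two_three_eq]
  ring

variable {hminus hplus y}

lemma alpha_three_two_eq (h : ContDiffAt ℝ 2 (alpha hminus hplus 2 0) y) :
    alpha hminus hplus 3 2 y = -(1 / 12) * (Δ (bracketB hminus hplus)) y := by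
  rw [bracketB_eq, InnerProductSpace.laplacian_smul _ h, alpha_add_two hminus hplus y 1 0,
    smul_eq_mul]
  push_cast
  ring

lemma alpha_three_three_eq (h : ContDiffAt ℝ 2 (alpha hminus hplus 2 1) y) :
    alpha hminus hplus 3 3 y = -(1 / 36) * (Δ (bracketA hminus hplus)) y := by
  rw [bracketA_eq, InnerProductSpace.laplacian_smul _ h, alpha_add_two hminus hplus y 1 1,
    smul_eq_mul]
  push_cast
  ring

lemma alpha_three_four_eq (h : ContDiffAt ℝ 2 (alpha hminus hplus 2 2) y) :
    alpha hminus hplus 3 4 y = 1 / 24 * (Δ (Δ (heightProd hminus hplus))) y := by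
  rw [laplacian_heightProd_eq, InnerProductSpace.laplacian_smul _ h,
    alpha_add_two hminus hplus y 1 2, smul_eq_mul]
  push_cast
  ring

lemma alpha_three_five_eq (h : ContDiffAt ℝ 2 (alpha hminus hplus 2 3) y) :
    alpha hminus hplus 3 5 y = 1 / 120 * (Δ (Δ (heightDiff hminus hplus))) y := by
  rw [laplacian_heightDiff_eq, InnerProductSpace.laplacian_smul _ h,
    alpha_add_two hminus hplus y 1 3, smul_eq_mul]
  push_cast
  ring

/-- The length of the polynomial in `xₙ / ε` with coefficients `α_i^{(2j)}`. -/
def layerLength (j : ℕ) : ℕ := if j = 1 then 3 else 2 * j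

/-- Each layer vanishes at `h₊` and at `-h₋`. -/
lemma sum_alpha_mul_pow_eq_zero {j : ℕ} (hj : j ∈ Finset.Icc 1 3) {t : ℝ}
    (ht : t = hplus y ∨ t = -hminus y) :
    ∑ i ∈ Finset.range (layerLength j), alpha hminus hplus j i y * t ^ i = 0 := by
  -- Both endpoints are roots of `t² = p + d t`. Each layer is a multiple of `t² - d t - p`, and the
  -- factors given to `linear_combination` below are the quotients.
  have hq : t ^ 2 = heightProd hminus hplus y + heightDiff hminus hplus y * t := by
    rcases ht with rfl | rfl <;> simp only [heightProd, heightDiff] <;> ring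
  obtain ⟨h1, h3⟩ := Finset.mem_Icc.mp hj
  interval_cases j
  · simp only [layerLength, if_true, Finset.sum_range_succ, Finset.sum_range_zero, alpha]
    linear_combination -hq
  · have hl : layerLength 2 = 4 := rfl
    simp only [hl, Finset.sum_range_succ, Finset.sum_range_zero, alpha_two_one, alpha_two_zero]
    linear_combination (alpha hminus hplus 2 2 y +
      alpha hminus hplus 2 3 y * (t + heightDiff hminus hplus y)) * hq
  · have hl : layerLength 3 = 6 := rfl
    simp only [hl, Finset.sum_range_succ, Finset.sum_range_zero, alpha_three_one, alpha_three_zero]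
    generalize heightDiff hminus hplus y = d at *
    generalize heightProd hminus hplus y = p at *
    linear_combination (alpha hminus hplus 3 2 y + alpha hminus hplus 3 3 y * (t + d) +
      alpha hminus hplus 3 4 y * (t ^ 2 + d * t + d ^ 2 + p) +
      alpha hminus hplus 3 5 y * (t ^ 3 + d * t ^ 2 + (d ^ 2 + p) * t + d ^ 3 + 2 * d * p)) * hq

variable (hminus hplus y)

lemma moment_alpha_one : moment hminus hplus 3 (alpha hminus hplus 1) y =
    1 / 6 * thickness hminus hplus y ^ 3 := by
  simp only [moment, Finset.sum_range_succ, Finset.sum_range_zero, alpha, heightDiff, heightProd,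
    thickness]
  push_cast
  ring

lemma moment_alpha_two : moment hminus hplus 4 (alpha hminus hplus 2) y =
    1 / 24 * (thickness hminus hplus y ^ 3 *
      (heightDiff hminus hplus y * (Δ (heightDiff hminus hplus)) y +
        2 * (Δ (heightProd hminus hplus)) y)) := by
  simp only [moment, Finset.sum_range_succ, Finset.sum_range_zero, alpha_two_zero, alpha_two_one,
    alpha_two_two_eq, alpha_two_three_eq]
  generalize (Δ (heightDiff hminus hplus)) y = D
  generalize (Δ (heightProd hminus hplus)) y = P
  simp only [heightDiff, heightProd, thickness]
  push_cast
  ring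

/-- An identity for arbitrary coefficients `a_0, …, a_5`: `h₊^{i+1} - (-h₋)^{i+1}` is `H` times a
polynomial in `d` and `p`, and `H² = d² + 4p` brings it to the displayed form. -/
lemma moment_alpha_three : moment hminus hplus 6 (alpha hminus hplus 3) y =
    1 / 6 * (thickness hminus hplus y ^ 3 * heightDiff hminus hplus y ^ 3 +
      3 * heightDiff hminus hplus y * heightProd hminus hplus y ^ 2 * thickness hminus hplus y) *
        alpha hminus hplus 3 5 y +
    1 / 5 * (thickness hminus hplus y ^ 3 * heightDiff hminus hplus y ^ 2 +
      heightProd hminus hplus y * thickness hminus hplus y *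
        (heightProd hminus hplus y - heightDiff hminus hplus y ^ 2)) * alpha hminus hplus 3 4 y +
    1 / 4 * (thickness hminus hplus y ^ 3 * heightDiff hminus hplus y -
      2 * heightDiff hminus hplus y * heightProd hminus hplus y * thickness hminus hplus y) *
        alpha hminus hplus 3 3 y +
    1 / 3 * (thickness hminus hplus y ^ 3 -
      3 * heightProd hminus hplus y * thickness hminus hplus y) * alpha hminus hplus 3 2 y +
    1 / 2 * heightDiff hminus hplus y * thickness hminus hplus y * alpha hminus hplus 3 1 y +
    thickness hminus hplus y * alpha hminus hplus 3 0 y := by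
  simp only [moment, Finset.sum_range_succ, Finset.sum_range_zero]
  generalize alpha hminus hplus 3 = a
  simp only [heightDiff, heightProd, thickness]
  push_cast
  ring

end Algebra

/-! ### The truncated expansion and its Laplacian -/

section Approximation

variable {m : ℕ}

/-- The truncated expansion `∑ j ≤ 3, ε^{2j} ∑ i, b_i^{(2j)}(x') (xₙ / ε) ^ i`. -/
noncomputable def approx (b : ℕ → ℕ → Space m → ℝ) (ε : ℝ) : Space (m + 1) → ℝ :=
  ε ^ 2 • profile 3 (b 1) ε + ε ^ 4 • profile 4 (b 2) ε + ε ^ 6 • profile 6 (b 3) ε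

lemma contDiffAt_approx {b : ℕ → ℕ → Space m → ℝ} {x : Space (m + 1)}
    (hb : ∀ j ∈ Finset.Icc 1 3, ∀ i < layerLength j, ContDiffAt ℝ 2 (b j i) (horizontal x))
    (ε : ℝ) : ContDiffAt ℝ 2 (approx b ε) x := by
  have c1 : ContDiffAt ℝ 2 (ε ^ 2 • profile 3 (b 1) ε) x :=
    (contDiffAt_profile (n := 3) (hb 1 (by decide)) ε).const_smul (ε ^ 2)
  have c2 : ContDiffAt ℝ 2 (ε ^ 4 • profile 4 (b 2) ε) x :=
    (contDiffAt_profile (n := 4) (hb 2 (by decide)) ε).const_smul (ε ^ 4)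
  have c3 : ContDiffAt ℝ 2 (ε ^ 6 • profile 6 (b 3) ε) x :=
    (contDiffAt_profile (n := 6) (hb 3 (by decide)) ε).const_smul (ε ^ 6)
  exact (c1.add c2).add c3

/-- The sum telescopes: `ε^{2j}` times the horizontal Laplacian of layer `j` cancels the vertical
second derivative of layer `j + 1`, which carries `ε^{2j+2} / ε²`. What survives is `-2` from the
first layer and the horizontal Laplacian of the third. -/
lemma laplacian_approx {b : ℕ → ℕ → Space m → ℝ} {x : Space (m + 1)}
    (hb : ∀ j ∈ Finset.Icc 1 3, ∀ i < layerLength j, ContDiffAt ℝ 2 (b j i) (horizontal x))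
    (htop : b 1 2 =ᶠ[𝓝 (horizontal x)] fun _ => -1)
    (hrec : ∀ j ∈ Finset.Icc 1 2, ∀ i < 2 * j, b (j + 1) (i + 2) (horizontal x) =
      -(1 / (((i : ℝ) + 2) * ((i : ℝ) + 1))) * (Δ (b j i)) (horizontal x))
    {ε : ℝ} (hε : ε ≠ 0) : (Δ (approx b ε)) x = -2 +
      ε ^ 6 * ∑ i ∈ Finset.range 6, (Δ (b 3 i)) (horizontal x) * (vertical x / ε) ^ i := by
  have c1 := contDiffAt_profile (n := 3) (hb 1 (by decide)) ε
  have c2 := contDiffAt_profile (n := 4) (hb 2 (by decide)) ε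
  have c3 := contDiffAt_profile (n := 6) (hb 3 (by decide)) ε
  -- The coefficient of `s²` in the first layer has no successor in the second; being locally
  -- constant, it needs none.
  have hΔtop : (Δ (b 1 2)) (horizontal x) = 0 := by
    rw [(InnerProductSpace.laplacian_congr_nhds htop).eq_of_nhds]
    simp
  have r20 := hrec 1 (by decide) 0 (by norm_num)
  have r21 := hrec 1 (by decide) 1 (by norm_num)
  have r30 := hrec 2 (by decide) 0 (by norm_num)
  have r31 := hrec 2 (by decide) 1 (by norm_num)
  have r32 := hrec 2 (by decide) 2 (by norm_num)
  have r33 := hrec 2 (by decide) 3 (by norm_num)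
  have d1 : ContDiffAt ℝ 2 (ε ^ 2 • profile 3 (b 1) ε) x := c1.const_smul (ε ^ 2)
  have d2 : ContDiffAt ℝ 2 (ε ^ 4 • profile 4 (b 2) ε) x := c2.const_smul (ε ^ 4)
  have d3 : ContDiffAt ℝ 2 (ε ^ 6 • profile 6 (b 3) ε) x := c3.const_smul (ε ^ 6)
  have d12 : ContDiffAt ℝ 2 (ε ^ 2 • profile 3 (b 1) ε + ε ^ 4 • profile 4 (b 2) ε) x := d1.add d2
  rw [approx, ContDiffAt.laplacian_add d12 d3, d1.laplacian_add d2, InnerProductSpace.laplacian_smul _ c1,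
    InnerProductSpace.laplacian_smul _ c2, InnerProductSpace.laplacian_smul _ c3,
    laplacian_profile (n := 3) (hb 1 (by decide)), laplacian_profile (n := 4) (hb 2 (by decide)),
    laplacian_profile (n := 6) (hb 3 (by decide))]
  norm_num at r20 r21 r30 r31 r32 r33
  simp only [Finset.sum_range_succ, Finset.sum_range_zero, smul_eq_mul, hΔtop, htop.eq_of_nhds,
    r20, r21, r30, r31, r32, r33]
  norm_num
  field_simp
  ring

lemma continuousOn_approx {b : ℕ → ℕ → Space m → ℝ} {s : Set (Space m)}
    (hb : ∀ j ∈ Finset.Icc 1 3, ∀ i < layerLength j, ContinuousOn (b j i) s) (ε : ℝ) :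
    ContinuousOn (approx b ε) (horizontal ⁻¹' s) :=
  (((continuousOn_profile (n := 3) (hb 1 (by decide)) ε).const_smul _).add
    ((continuousOn_profile (n := 4) (hb 2 (by decide)) ε).const_smul _)).add
      ((continuousOn_profile (n := 6) (hb 3 (by decide)) ε).const_smul _)

end Approximation

/-! ### Error estimate and integral of the expansion -/

section Expansion

variable {m : ℕ} {ω : Set (Space m)} {hminus hplus : Space m → ℝ}

/-- All coefficients of the truncated expansion extend continuously to the closure. -/
lemma exists_coefficient_extension (hω : IsOpen ω)
    (hα : ∀ j ∈ Finset.Icc 1 3, ∀ i < 2 * j, C2UpToBoundary ω (alpha hminus hplus j i)) :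
    ∃ b : ℕ → ℕ → Space m → ℝ, ∀ j ∈ Finset.Icc 1 3, ∀ i < layerLength j,
      ContinuousOn (b j i) (closure ω) ∧ EqOn (b j i) (alpha hminus hplus j i) ω ∧
        ∀ y ∈ ω, ContDiffAt ℝ 2 (b j i) y := by
  have key : ∀ j i, ∃ b : Space m → ℝ, j ∈ Finset.Icc 1 3 → i < layerLength j →
      ContinuousOn b (closure ω) ∧ EqOn b (alpha hminus hplus j i) ω ∧
        ∀ y ∈ ω, ContDiffAt ℝ 2 b y := by
    intro j i
    by_cases h : j ∈ Finset.Icc 1 3 ∧ i < 2 * j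
    · obtain ⟨b, hb, hbα⟩ := (hα j h.1 i h.2).exists_extension
      refine ⟨b, fun _ _ => ⟨hb, hbα, fun y hy => ?_⟩⟩
      exact ((hα j h.1 i h.2).1.contDiffAt (hω.mem_nhds hy)).congr_of_eventuallyEq
        (hbα.eventuallyEq_of_mem (hω.mem_nhds hy))
    -- The only coefficient of the expansion not covered by `hα` is `α_2^{(2)} = -1`; all other
    -- indices here make the claim vacuous.
    · refine ⟨fun _ => -1, fun hj hi => ?_⟩
      have hcase : j = 1 ∧ i = 2 := by
        simp only [layerLength] at hi
        simp only [hj, true_and, not_lt] at h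
        split_ifs at hi <;> omega
      obtain ⟨rfl, rfl⟩ := hcase
      exact ⟨continuousOn_const, fun _ _ => rfl, fun _ _ => contDiffAt_const⟩
  choose b hb using key
  exact ⟨b, fun j hj i hi => hb j i hj hi⟩

/-- The truncated expansion satisfies the Dirichlet condition. -/
lemma approx_eq_zero_of_mem_frontier (hω : IsOpen ω)
    (h₁ : ContinuousOn hminus (closure ω)) (h₂ : ContinuousOn hplus (closure ω))
    (hH : ∀ y ∈ frontier ω, hminus y + hplus y = 0) {b : ℕ → ℕ → Space m → ℝ}
    (hb : ∀ j ∈ Finset.Icc 1 3, ∀ i < layerLength j,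
      ContinuousOn (b j i) (closure ω) ∧ EqOn (b j i) (alpha hminus hplus j i) ω)
    {ε : ℝ} (hε : ε ≠ 0) {x : Space (m + 1)}
    (hx : x ∈ frontier (thinDomain ω hminus hplus ε)) : approx b ε x = 0 := by
  have hvanish : ∀ h : Space m → ℝ, ContinuousOn h (closure ω) →
      (∀ y, h y = hplus y ∨ h y = -hminus y) → ∀ j ∈ Finset.Icc 1 3,
      EqOn (fun y => ∑ i ∈ Finset.range (layerLength j), b j i y * h y ^ i) (fun _ => 0)
        (closure ω) := by
    intro h hc hh j hj
    -- The vanishing of the layers is known for `α` in `ω` and passes to the extensions `b` on the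
    -- closure by continuity.
    refine EqOn.of_subset_closure (s := ω) (fun y hy => ?_) (continuousOn_finsetSum _ fun i hi =>
      (hb j hj i (Finset.mem_range.mp hi)).1.mul (hc.pow i)) continuousOn_const subset_closure
      subset_rfl
    rw [← sum_alpha_mul_pow_eq_zero hj (hh y)]
    exact Finset.sum_congr rfl fun i hi => by rw [(hb j hj i (Finset.mem_range.mp hi)).2 hy]
  obtain ⟨hy, hcase⟩ := frontier_thinDomain_subset hω h₁ h₂ hH hx
  have hprofile : ∀ j ∈ Finset.Icc 1 3, profile (layerLength j) (b j) ε x = 0 := by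
    intro j hj
    rcases hcase with h | h
    · have hs : vertical x / ε = hplus (horizontal x) := by rw [h]; field_simp
      rw [profile, hs]
      exact hvanish hplus h₂ (fun _ => Or.inl rfl) j hj hy
    · have hs : vertical x / ε = -hminus (horizontal x) := by rw [h]; field_simp
      rw [profile, hs]
      exact hvanish (fun y => -hminus y) h₁.neg (fun _ => Or.inr rfl) j hj hy
  have p1 : profile 3 (b 1) ε x = 0 := hprofile 1 (by decide)
  have p2 : profile 4 (b 2) ε x = 0 := hprofile 2 (by decide)
  have p3 : profile 6 (b 3) ε x = 0 := hprofile 3 (by decide)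
  simp [approx, p1, p2, p3]

/-- The torsion function differs from the truncated expansion by `O(ε⁸)`, uniformly. -/
lemma exists_abs_sub_approx_le (hω : IsOpen ω) (hωb : Bornology.IsBounded ω)
    (h₁ : ContinuousOn hminus (closure ω)) (h₂ : ContinuousOn hplus (closure ω))
    (hH : ∀ y ∈ frontier ω, hminus y + hplus y = 0)
    (hα : ∀ j ∈ Finset.Icc 1 3, ∀ i < 2 * j, C2UpToBoundary ω (alpha hminus hplus j i))
    {b : ℕ → ℕ → Space m → ℝ}
    (hb : ∀ j ∈ Finset.Icc 1 3, ∀ i < layerLength j,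
      ContinuousOn (b j i) (closure ω) ∧ EqOn (b j i) (alpha hminus hplus j i) ω ∧
        ∀ y ∈ ω, ContDiffAt ℝ 2 (b j i) y)
    {K : ℝ} (hK : ∀ y ∈ closure ω, |hminus y| ≤ K ∧ |hplus y| ≤ K) :
    ∃ C : ℝ, ∀ ε : ℝ, 0 < ε → Bornology.IsBounded (thinDomain ω hminus hplus ε) →
      ∀ u, IsTorsionFunction (thinDomain ω hminus hplus ε) u →
        ∀ x ∈ thinDomain ω hminus hplus ε, |u x - approx b ε x| ≤ C * ε ^ 8 := by
  have hlap : ∀ j ∈ Finset.Icc 1 3, ∀ i < layerLength j, ∀ y ∈ ω,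
      (Δ (b j i)) y = (Δ (alpha hminus hplus j i)) y := fun j hj i hi y hy =>
    (InnerProductSpace.laplacian_congr_nhds
      ((hb j hj i hi).2.1.eventuallyEq_of_mem (hω.mem_nhds hy))).eq_of_nhds
  have hM : ∀ i, ∃ M : ℝ, i < 6 → ∀ y ∈ ω, |(Δ (b 3 i)) y| ≤ M := by
    intro i
    by_cases hi : i < 6
    · obtain ⟨M, hM⟩ := (hα 3 (by decide) i hi).exists_bound_laplacian hωb
      exact ⟨M, fun _ y hy => by rw [hlap 3 (by decide) i hi y hy]; exact hM y hy⟩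
    · exact ⟨0, fun h => absurd h hi⟩
  choose M hM using hM
  -- The sum bounds the residual divided by `ε⁶`, since `|xₙ / ε| ≤ |K|`; the added `1` gives the
  -- strict inequality that the slab bound asks for.
  set C : ℝ := 1 + ∑ i ∈ Finset.range 6, |M i| * |K| ^ i with hC
  have hCpos : 0 < C := by positivity
  refine ⟨C * K ^ 2 / 2, fun ε hε hbdd u hu x hx => ?_⟩
  have hopen : IsOpen (thinDomain ω hminus hplus ε) :=
    isOpen_thinDomain hω (h₁.mono subset_closure) (h₂.mono subset_closure)
  have hsm : ∀ x ∈ thinDomain ω hminus hplus ε, ContDiffAt ℝ 2 (approx b ε) x := fun x hx =>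
    contDiffAt_approx (fun j hj i hi => (hb j hj i hi).2.2 _ hx.1) ε
  have hΔ : ∀ x ∈ thinDomain ω hminus hplus ε, |(Δ (u - approx b ε)) x| < C * ε ^ 6 := by
    intro x hx
    have hs : |vertical x / ε| ≤ |K| := by
      rw [abs_div, abs_of_pos hε, div_le_iff₀ hε]
      refine (abs_vertical_le hε h₁ h₂ hK (subset_closure hx)).trans ?_
      nlinarith [le_abs_self K]
    have htop : b 1 2 =ᶠ[𝓝 (horizontal x)] fun _ => -1 :=
      (hb 1 (by decide) 2 (by decide)).2.1.eventuallyEq_of_mem (hω.mem_nhds hx.1)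
    have hrec : ∀ j ∈ Finset.Icc 1 2, ∀ i < 2 * j, b (j + 1) (i + 2) (horizontal x) =
        -(1 / (((i : ℝ) + 2) * ((i : ℝ) + 1))) * (Δ (b j i)) (horizontal x) := by
      intro j hj i hi
      obtain ⟨hj1, hj2⟩ := Finset.mem_Icc.mp hj
      obtain ⟨k, rfl⟩ := Nat.exists_eq_add_of_le' hj1
      rw [(hb (k + 2) (Finset.mem_Icc.mpr ⟨by omega, by omega⟩) (i + 2)
          (by simp only [layerLength]; split_ifs <;> omega)).2.1 hx.1, alpha_add_two,
        hlap (k + 1) (Finset.mem_Icc.mpr ⟨by omega, by omega⟩) i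
          (by simp only [layerLength]; split_ifs <;> omega) _ hx.1]
    rw [(hu.contDiffOn.contDiffAt (hopen.mem_nhds hx)).laplacian_sub (hsm x hx),
      laplacian_approx (fun j hj i hi => (hb j hj i hi).2.2 _ hx.1) htop hrec hε.ne']
    have heq := hu.equation x hx
    set S := ∑ i ∈ Finset.range 6, (Δ (b 3 i)) (horizontal x) * (vertical x / ε) ^ i with hS
    have hSle : |S| ≤ ∑ i ∈ Finset.range 6, |M i| * |K| ^ i := by
      refine (Finset.abs_sum_le_sum_abs _ _).trans (Finset.sum_le_sum fun i hi => ?_)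
      rw [abs_mul, abs_pow]
      exact mul_le_mul ((hM i (Finset.mem_range.mp hi) _ hx.1).trans (le_abs_self _))
        (pow_le_pow_left₀ (abs_nonneg _) hs i) (by positivity) (abs_nonneg _)
    have hval : (Δ u) x - (-2 + ε ^ 6 * S) = -(ε ^ 6 * S) := by linarith
    rw [hval, abs_neg, abs_mul, abs_of_pos (by positivity : (0 : ℝ) < ε ^ 6), mul_comm]
    exact mul_lt_mul_of_pos_right (by linarith) (by positivity)
  have hcl : ContinuousOn (u - approx b ε) (closure (thinDomain ω hminus hplus ε)) :=
    hu.continuousOn.sub ((continuousOn_approx (fun j hj i hi => (hb j hj i hi).1) ε).mono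
      fun x hx => (closure_thinDomain_subset h₁ h₂ hx).1)
  -- The half-width `ε K` enters squared and raises the order of the residual from `ε⁶` to `ε⁸`.
  have key := abs_le_of_abs_laplacian_lt hopen hbdd (fun x hx => abs_vertical_le hε h₁ h₂ hK hx)
    (by positivity : 0 ≤ C * ε ^ 6)
    (fun x hx => (hu.contDiffOn x hx).sub (hsm x hx).contDiffWithinAt) hcl hΔ
    (fun x hx => by
      rw [hu.boundary x hx, approx_eq_zero_of_mem_frontier hω h₁ h₂ hH
        (fun j hj i hi => ⟨(hb j hj i hi).1, (hb j hj i hi).2.1⟩) hε.ne' hx, sub_zero])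
    (subset_closure hx)
  calc |u x - approx b ε x| ≤ C * ε ^ 6 * (ε * K) ^ 2 / 2 := key
    _ = C * K ^ 2 / 2 * ε ^ 8 := by ring

/-- The integral of the truncated expansion. -/
lemma setIntegral_approx (hω : IsOpen ω) (hωb : Bornology.IsBounded ω)
    {ε : ℝ} (hbdd : Bornology.IsBounded (thinDomain ω hminus hplus ε)) (hε : 0 < ε)
    (h₁ : ContinuousOn hminus (closure ω)) (h₂ : ContinuousOn hplus (closure ω))
    (hH : ∀ y ∈ ω, 0 < hminus y + hplus y) {b : ℕ → ℕ → Space m → ℝ}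
    (hb : ∀ j ∈ Finset.Icc 1 3, ∀ i < layerLength j, ContinuousOn (b j i) (closure ω)) :
    IntegrableOn (approx b ε) (thinDomain ω hminus hplus ε) ∧
    ∫ x in thinDomain ω hminus hplus ε, approx b ε x =
      ε ^ 3 * (∫ y in ω, moment hminus hplus 3 (b 1) y) +
      ε ^ 5 * (∫ y in ω, moment hminus hplus 4 (b 2) y) +
      ε ^ 7 * ∫ y in ω, moment hminus hplus 6 (b 3) y := by
  obtain ⟨i1, -, e1⟩ := setIntegral_profile (n := 3) hω hωb hbdd hε h₁ h₂ hH (hb 1 (by decide))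
  obtain ⟨i2, -, e2⟩ := setIntegral_profile (n := 4) hω hωb hbdd hε h₁ h₂ hH (hb 2 (by decide))
  obtain ⟨i3, -, e3⟩ := setIntegral_profile (n := 6) hω hωb hbdd hε h₁ h₂ hH (hb 3 (by decide))
  have j1 := i1.const_mul (ε ^ 2)
  have j2 := i2.const_mul (ε ^ 4)
  have j3 := i3.const_mul (ε ^ 6)
  refine ⟨(j1.add j2).add j3, ?_⟩
  have hsplit : ∀ x, approx b ε x = ε ^ 2 * profile 3 (b 1) ε x + ε ^ 4 * profile 4 (b 2) ε x +
      ε ^ 6 * profile 6 (b 3) ε x := fun x => rfl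
  have j12 : Integrable (fun x => ε ^ 2 * profile 3 (b 1) ε x + ε ^ 4 * profile 4 (b 2) ε x)
      (volume.restrict (thinDomain ω hminus hplus ε)) := j1.add j2
  simp only [hsplit]
  rw [integral_add j12 j3, integral_add j1 j2, integral_const_mul, integral_const_mul,
    integral_const_mul, e1, e2, e3]
  ring

end Expansion

end ThinDomain

/-! ### The expansion of the torsional rigidity -/

theorem theorem2p2 {m : ℕ} (ω : Set (ThinDomain.Space m))
    (hω_open : IsOpen ω) (hω_conn : IsConnected ω) (hω_bdd : Bornology.IsBounded ω)
    (hω_C1 : ThinDomain.HasC1Boundary ω)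
    (hminus hplus : ThinDomain.Space m → ℝ)
    (hminus_cont : ContinuousOn hminus (closure ω)) (hminus_C1 : ContDiffOn ℝ 1 hminus ω)
    (hplus_cont : ContinuousOn hplus (closure ω)) (hplus_C1 : ContDiffOn ℝ 1 hplus ω)
    (H d p : ThinDomain.Space m → ℝ)
    (hH : H = ThinDomain.thickness hminus hplus)
    (hd : d = ThinDomain.heightDiff hminus hplus)
    (hp : p = ThinDomain.heightProd hminus hplus)
    (hH_pos : ∀ y ∈ ω, 0 < H y) (hH_zero : ∀ y ∈ frontier ω, H y = 0)
    (hα : ∀ j ∈ Finset.Icc 1 3, ∀ i < 2 * j,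
      ThinDomain.C2UpToBoundary ω (ThinDomain.alpha hminus hplus j i))
    (α₁ α₀ A B F₅ F₇ : ThinDomain.Space m → ℝ)
    (hα₁ : α₁ = ThinDomain.alpha hminus hplus 3 1)
    (hα₀ : α₀ = ThinDomain.alpha hminus hplus 3 0)
    (hA : A = ThinDomain.bracketA hminus hplus)
    (hB : B = ThinDomain.bracketB hminus hplus)
    (hF₅ : F₅ = fun y => H y ^ 3 * (d y * (Δ d) y + 2 * (Δ p) y))
    (hF₇ : F₇ = fun y =>
      1 / 720 * (H y ^ 3 * d y ^ 3 + 3 * d y * p y ^ 2 * H y) * (Δ (Δ d)) y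
      + 1 / 120 * (H y ^ 3 * d y ^ 2 + p y * H y * (p y - d y ^ 2)) * (Δ (Δ p)) y
      - 1 / 144 * (H y ^ 3 * d y - 2 * d y * p y * H y) * (Δ A) y
      - 1 / 36 * (H y ^ 3 - 3 * p y * H y) * (Δ B) y
      + 1 / 2 * d y * H y * α₁ y + H y * α₀ y)
    (ε₀ : ℝ) (hε₀ : 0 < ε₀) (u : ℝ → ThinDomain.Space (m + 1) → ℝ)
    (hu : ∀ ε ∈ Ioo 0 ε₀,
      ThinDomain.IsTorsionFunction (ThinDomain.thinDomain ω hminus hplus ε) (u ε)) :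
    (∀ y ∈ ω, α₁ y =
      1 / 12 * d y * (Δ B) y + 1 / 36 * (d y ^ 2 + p y) * (Δ A) y
      - 1 / 24 * d y * (d y ^ 2 + 2 * p y) * (Δ (Δ p)) y
      - 1 / 120 * (d y ^ 4 + 3 * d y ^ 2 * p y + p y ^ 2) * (Δ (Δ d)) y) ∧
    (∀ y ∈ ω, α₀ y =
      p y / 12 * (Δ B) y + d y * p y / 36 * (Δ A) y
      - 1 / 24 * p y * (d y ^ 2 + p y) * (Δ (Δ p)) y
      - 1 / 120 * d y * p y * (d y ^ 2 + 2 * p y) * (Δ (Δ d)) y) ∧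
    (∀ ε ∈ Ioo 0 ε₀, IntegrableOn (u ε) (ThinDomain.thinDomain ω hminus hplus ε)) ∧
    IntegrableOn (fun y => H y ^ 3) ω ∧ IntegrableOn F₅ ω ∧ IntegrableOn F₇ ω ∧
    (fun ε : ℝ => (∫ x in ThinDomain.thinDomain ω hminus hplus ε, u ε x) -
        (ε ^ 3 / 6 * (∫ y in ω, H y ^ 3) + ε ^ 5 / 24 * (∫ y in ω, F₅ y)
          + ε ^ 7 * ∫ y in ω, F₇ y))
      =O[𝓝[>] 0] fun ε : ℝ => ε ^ 8 := by
  have h₁ := hminus_cont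
  have h₂ := hplus_cont
  have hpos : ∀ y ∈ ω, 0 < hminus y + hplus y := fun y hy => by
    have := hH_pos y hy
    rwa [hH] at this
  have hzero : ∀ y ∈ frontier ω, hminus y + hplus y = 0 := fun y hy => by
    have := hH_zero y hy
    rwa [hH] at this
  have hsm : ∀ i < 4, ∀ y ∈ ω, ContDiffAt ℝ 2 (ThinDomain.alpha hminus hplus 2 i) y :=
    fun i hi y hy => (hα 2 (by decide) i hi).1.contDiffAt (hω_open.mem_nhds hy)
  obtain ⟨K₁, hK₁⟩ := hω_bdd.isCompact_closure.exists_bound_of_continuousOn h₁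
  obtain ⟨K₂, hK₂⟩ := hω_bdd.isCompact_closure.exists_bound_of_continuousOn h₂
  have hK : ∀ y ∈ closure ω, |hminus y| ≤ |K₁| + |K₂| ∧ |hplus y| ≤ |K₁| + |K₂| := fun y hy =>
    ⟨(hK₁ y hy).trans (by linarith [le_abs_self K₁, abs_nonneg K₂]),
      (hK₂ y hy).trans (by linarith [le_abs_self K₂, abs_nonneg K₁])⟩
  obtain ⟨R, hR0, hR⟩ := hω_bdd.subset_closedBall_lt 0 0
  have hbdd : ∀ ε, 0 < ε → Bornology.IsBounded (ThinDomain.thinDomain ω hminus hplus ε) := by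
    intro ε hε
    refine (Metric.isBounded_closedBall (x := 0) (r := R + ε * (|K₁| + |K₂|))).subset ?_
    -- Absorbing `ε` into the height functions and taking parameter `1` avoids the restriction `ε ≤
    -- 1`.
    have h := ThinDomain.thinDomain_subset_closedBall (ω := ω) (hminus := fun y => ε * hminus y)
      (hplus := fun y => ε * hplus y) (ε := 1) one_pos le_rfl
      (by positivity : 0 ≤ ε * (|K₁| + |K₂|)) hR0.le hR (continuousOn_const.mul h₁)
      (continuousOn_const.mul h₂) (fun y hy => by
        rw [abs_mul, abs_mul, abs_of_pos hε]
        exact ⟨mul_le_mul_of_nonneg_left (hK y hy).1 hε.le,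
          mul_le_mul_of_nonneg_left (hK y hy).2 hε.le⟩)
    intro x hx
    exact h ⟨hx.1, by simpa using hx.2.1, by simpa using hx.2.2⟩
  obtain ⟨b, hb⟩ := ThinDomain.exists_coefficient_extension hω_open hα
  -- Each integrand of the expansion agrees on `ω` with a moment of the extensions `b`, which is
  -- continuous on the compact closure; this gives integrability.
  have hmoment : ∀ j ∈ Finset.Icc 1 3, ∀ f : ThinDomain.Space m → ℝ,
      (∀ y ∈ ω, f y = ThinDomain.moment hminus hplus (ThinDomain.layerLength j)
        (ThinDomain.alpha hminus hplus j) y) →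
      EqOn (ThinDomain.moment hminus hplus (ThinDomain.layerLength j) (b j)) f ω ∧
        IntegrableOn f ω := by
    intro j hj f hf
    have heq : EqOn (ThinDomain.moment hminus hplus (ThinDomain.layerLength j) (b j)) f ω := by
      intro y hy
      rw [hf y hy]
      exact Finset.sum_congr rfl fun i hi => by
        rw [(hb j hj i (Finset.mem_range.mp hi)).2.1 hy]
    refine ⟨heq, IntegrableOn.congr_fun (ThinDomain.integrableOn_of_continuousOn_closure hω_bdd
      (ThinDomain.continuousOn_moment h₁ h₂ fun i hi => (hb j hj i hi).1)) heq
      hω_open.measurableSet⟩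
  obtain ⟨m1, I1⟩ := hmoment 1 (by decide) (fun y => 1 / 6 * H y ^ 3) fun y _ => by
    rw [hH]
    exact (ThinDomain.moment_alpha_one hminus hplus y).symm
  obtain ⟨m2, I2⟩ := hmoment 2 (by decide) (fun y => 1 / 24 * F₅ y) fun y _ => by
    rw [hF₅, hH, hd, hp]
    exact (ThinDomain.moment_alpha_two hminus hplus y).symm
  obtain ⟨m3, I3⟩ := hmoment 3 (by decide) F₇ fun y hy => by
    refine Eq.trans ?_ (ThinDomain.moment_alpha_three hminus hplus y).symm
    rw [ThinDomain.alpha_three_two_eq (hsm 0 (by norm_num) y hy),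
      ThinDomain.alpha_three_three_eq (hsm 1 (by norm_num) y hy),
      ThinDomain.alpha_three_four_eq (hsm 2 (by norm_num) y hy),
      ThinDomain.alpha_three_five_eq (hsm 3 (by norm_num) y hy), hF₇, hα₁, hα₀, hA, hB, hH, hd, hp]
    ring
  refine ⟨fun y hy => ?_, fun y hy => ?_, fun ε hε => ?_, ?_, ?_, I3, ?_⟩
  · rw [hα₁, ThinDomain.alpha_three_one, ThinDomain.alpha_three_two_eq (hsm 0 (by norm_num) y hy),
      ThinDomain.alpha_three_three_eq (hsm 1 (by norm_num) y hy),
      ThinDomain.alpha_three_four_eq (hsm 2 (by norm_num) y hy),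
      ThinDomain.alpha_three_five_eq (hsm 3 (by norm_num) y hy), hA, hB, hd, hp]
    ring
  · rw [hα₀, ThinDomain.alpha_three_zero, ThinDomain.alpha_three_two_eq (hsm 0 (by norm_num) y hy),
      ThinDomain.alpha_three_three_eq (hsm 1 (by norm_num) y hy),
      ThinDomain.alpha_three_four_eq (hsm 2 (by norm_num) y hy),
      ThinDomain.alpha_three_five_eq (hsm 3 (by norm_num) y hy), hA, hB, hd, hp]
    ring
  · exact ThinDomain.integrableOn_of_continuousOn_closure (hbdd ε hε.1) (hu ε hε).continuousOn
  · exact (I1.const_mul 6).congr (Eventually.of_forall fun y => by simp only; ring)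
  · exact (I2.const_mul 24).congr (Eventually.of_forall fun y => by simp only; ring)
  obtain ⟨C, hC⟩ := ThinDomain.exists_abs_sub_approx_le hω_open hω_bdd h₁ h₂ hzero hα hb hK
  -- One ball containing all the domains with `ε ≤ 1`. A bounded volume is enough, since the
  -- pointwise error is already `O(ε⁸)`.
  set Q : Set (ThinDomain.Space (m + 1)) := Metric.closedBall 0 (R + (|K₁| + |K₂|)) with hQ
  refine IsBigO.of_bound (|C| * volume.real Q) ?_
  filter_upwards [Ioo_mem_nhdsGT (lt_min hε₀ one_pos)] with ε hε
  have hεpos : 0 < ε := hε.1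
  have hε1 : ε ≤ 1 := (hε.2.trans_le (min_le_right _ _)).le
  have hεI : ε ∈ Ioo 0 ε₀ := ⟨hεpos, hε.2.trans_le (min_le_left _ _)⟩
  obtain ⟨hVi, hV⟩ := ThinDomain.setIntegral_approx hω_open hω_bdd (hbdd ε hεpos) hεpos h₁ h₂ hpos
    (fun j hj i hi => (hb j hj i hi).1)
  have hui := ThinDomain.integrableOn_of_continuousOn_closure (hbdd ε hεpos)
    (hu ε hεI).continuousOn
  have hsub : ThinDomain.thinDomain ω hminus hplus ε ⊆ Q :=
    ThinDomain.thinDomain_subset_closedBall hεpos hε1 (by positivity) hR0.le hR h₁ h₂ hK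
  have hQfin : volume Q < ⊤ := measure_closedBall_lt_top
  have e1 : ∫ y in ω, ThinDomain.moment hminus hplus 3 (b 1) y = 1 / 6 * ∫ y in ω, H y ^ 3 := by
    rw [← integral_const_mul]
    exact setIntegral_congr_fun hω_open.measurableSet m1
  have e2 : ∫ y in ω, ThinDomain.moment hminus hplus 4 (b 2) y = 1 / 24 * ∫ y in ω, F₅ y := by
    rw [← integral_const_mul]
    exact setIntegral_congr_fun hω_open.measurableSet m2
  have e3 : ∫ y in ω, ThinDomain.moment hminus hplus 6 (b 3) y = ∫ y in ω, F₇ y :=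
    setIntegral_congr_fun hω_open.measurableSet m3
  have hdiff : (∫ x in ThinDomain.thinDomain ω hminus hplus ε, u ε x) -
      (ε ^ 3 / 6 * (∫ y in ω, H y ^ 3) + ε ^ 5 / 24 * (∫ y in ω, F₅ y) + ε ^ 7 * ∫ y in ω, F₇ y) =
      ∫ x in ThinDomain.thinDomain ω hminus hplus ε, (u ε x - ThinDomain.approx b ε x) := by
    rw [integral_sub hui hVi, hV, e1, e2, e3]
    ring
  rw [hdiff]
  have hle : ‖∫ x in ThinDomain.thinDomain ω hminus hplus ε, (u ε x - ThinDomain.approx b ε x)‖ ≤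
      |C| * ε ^ 8 * volume.real (ThinDomain.thinDomain ω hminus hplus ε) :=
    norm_setIntegral_le_of_norm_le_const ((measure_mono hsub).trans_lt hQfin) fun x hx =>
      (hC ε hεpos (hbdd ε hεpos) _ (hu ε hεI) x hx).trans
        (mul_le_mul_of_nonneg_right (le_abs_self C) (by positivity))
  calc _ ≤ |C| * ε ^ 8 * volume.real (ThinDomain.thinDomain ω hminus hplus ε) := hle
    _ ≤ |C| * ε ^ 8 * volume.real Q :=
      mul_le_mul_of_nonneg_left (measureReal_mono hsub hQfin.ne) (by positivity)
    _ = |C| * volume.real Q * ‖ε ^ 8‖ := by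
      rw [Real.norm_of_nonneg (by positivity)]
      ring
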